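/- Semirings are associative, with $0$ and $1$, $0$ being multiplicatively absorbing, and $0\neq 1$. A right ideal $K$ of a semiring $S$ is *subtractive* if $a\in K$ and $a+b\in K$ imply $b\in K$ for all $a,b\in S$; $S$ is *right subtractive* if all its right ideals are subtractive. A right $S$-semimodule is *cyclic* if it is a homomorphic image of the regular right semimodule $S_S$, and *projective* if it is a retract of a free right $S$-semimodule (a direct sum of copies of $S_S$); $S$ is a *right CP-semiring* if all cyclic right $S$-semimodules are projective. $S$ is *congruence-simple* if the diagonal and the universal congruences are the only semiring congruences on $S$, and *ideal-simple* if $0$ and $S$ are its only two-sided ideals. Let $\mathbf{B}=\{0,1\}$ be the Boolean semifield, in which $1+1=1$. **Corollary 4.11.** For a right subtractive semiring $S$ the following conditions are equivalent: 1. $S$ is a congruence-simple right CP-semiring; 2. $S$ is an ideal-simple right CP-semiring; 3. $S\cong M_n(D)$ for some division ring $D$ and some integer $n\ge 1$, or $S\cong\mathbf{B}$. -/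

import Mathlib

/-!
Semirings are Mathlib's `Semiring`.  A right `S`-semimodule is a commutative additive monoid `M`
with `Module Sᵐᵒᵖ M`; the regular right semimodule is `S` with its instance `Module Sᵐᵒᵖ S`
(`MulOpposite.op s • m = m * s`), so a right ideal of `S` is a `Submodule Sᵐᵒᵖ S`.
-/

universe u

/-- A subsemimodule `K` of `M` is subtractive if `m ∈ K` and `m + m' ∈ K` imply `m' ∈ K`.
Here `R` acts on the left; right `S`-semimodules are covered by `R = Sᵐᵒᵖ`. -/
def IsSubtractiveSubsemimodule {R M : Type*} [Semiring R] [AddCommMonoid M] [Module R M]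
    (K : Submodule R M) : Prop :=
  ∀ m m' : M, m ∈ K → m + m' ∈ K → m' ∈ K

/-- A semiring is right subtractive if every right ideal of it is subtractive. -/
def IsRightSubtractive (S : Type*) [Semiring S] : Prop :=
  ∀ K : Submodule Sᵐᵒᵖ S, IsSubtractiveSubsemimodule K

/-- A right `S`-semimodule is cyclic if it is a homomorphic image of the regular right
semimodule `S`. -/
def IsCyclicRightSemimodule (S M : Type*) [Semiring S] [AddCommMonoid M] [Module Sᵐᵒᵖ M] : Prop :=
  ∃ f : S →ₗ[Sᵐᵒᵖ] M, Function.Surjective f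

/-- A right CP-semiring: all cyclic right semimodules are projective, that is, retracts of free
right semimodules.  A cyclic right `S`-semimodule is isomorphic to a quotient of `S`, so it is
enough to consider semimodules in the universe of `S`. -/
def IsRightCPSemiring (S : Type u) [Semiring S] : Prop :=
  ∀ (M : Type u) [AddCommMonoid M] [Module Sᵐᵒᵖ M],
    IsCyclicRightSemimodule S M → Module.Projective Sᵐᵒᵖ M

/-- The diagonal congruence `⊥` and the universal congruence `⊤` are the only congruences. -/
def IsCongruenceSimple (S : Type*) [Semiring S] : Prop :=
  ∀ c : RingCon S, c = ⊥ ∨ c = ⊤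

/-- `0` and `S` are the only two-sided ideals (additive submonoids absorbing multiplication from
both sides). -/
def IsIdealSimple (S : Type*) [Semiring S] : Prop :=
  ∀ I : Ideal S, I.IsTwoSided → I = ⊥ ∨ I = ⊤

/-- The Boolean semifield `𝐁 = {0, 1}` with `1 + 1 = 1`: addition is `or`, multiplication
is `and`. -/
def BooleanSemifield : Type := Bool

instance : Zero BooleanSemifield := ⟨false⟩

instance : One BooleanSemifield := ⟨true⟩

instance : Add BooleanSemifield := ⟨Bool.or⟩

instance : Mul BooleanSemifield := ⟨Bool.and⟩

instance : CommSemiring BooleanSemifield where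
  add_assoc := Bool.or_assoc
  zero_add := Bool.false_or
  add_zero := Bool.or_false
  add_comm := Bool.or_comm
  mul_assoc := Bool.and_assoc
  one_mul := Bool.true_and
  mul_one := Bool.and_true
  mul_comm := Bool.and_comm
  left_distrib := Bool.and_or_distrib_left
  right_distrib := Bool.and_or_distrib_right
  zero_mul := Bool.false_and
  mul_zero := Bool.and_false
  nsmul := nsmulRec

/-! The additively invertible elements form a two-sided ideal, and differing by one of them is a
congruence, so either kind of simplicity makes `S` a ring or zerosumfree. For a ring, CP means
semisimple, and Wedderburn–Artin gives matrices. If `S` is zerosumfree, simplicity first forces `1 +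
1 = 1`. Splitting `S` modulo `xS` then gives `f + x * w = 1` with `f * x = 0`. Subtractivity
excludes nonzero nilpotents, so `f` is central; simplicity forces `f = 0` when `x ≠ 0`, and `x` is
right invertible. Finally, splitting the congruence that merges all nonzero elements forces each of
them to be `1`. -/

open MulOpposite

/-! ### Splitting cyclic quotients -/

section Splitting

variable {S : Type u} [Semiring S]

/-- Over a right CP-semiring the quotient of the regular right semimodule by a right congruence
splits, and the splitting is left multiplication by an element. -/
theorem IsRightCPSemiring.exists_splitting (h : IsRightCPSemiring S) (c : ModuleCon Sᵐᵒᵖ S) :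
    ∃ e : S, c.r e 1 ∧ ∀ a b, c.r a b → e * a = e * b := by
  let π : S →ₗ[Sᵐᵒᵖ] c.Quotient :=
    { toFun := fun x ↦ Quotient.mk c.toSetoid x
      map_add' := fun _ _ ↦ rfl
      map_smul' := fun _ _ ↦ rfl }
  have hπ : Function.Surjective π := Quotient.mk_surjective
  have := h c.Quotient ⟨π, hπ⟩
  obtain ⟨s, hs⟩ := Module.projective_lifting_property π LinearMap.id hπ
  have key (a : S) : s (π a) = s (π 1) * a := by
    have : π a = op a • π 1 := by rw [← map_smul]; simp
    rw [this, map_smul]; simp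
  refine ⟨s (π 1), Quotient.exact (LinearMap.congr_fun hs (π 1)), fun a b hab ↦ ?_⟩
  rw [← key, ← key, show π a = π b from Quotient.sound hab]

/-- The Bourne congruence `a + k = b + k'` with `k, k' ∈ K` attached to a right ideal `K`. -/
def bourneCon (K : Submodule Sᵐᵒᵖ S) : ModuleCon Sᵐᵒᵖ S where
  r a b := ∃ k ∈ K, ∃ k' ∈ K, a + k = b + k'
  iseqv :=
    { refl := fun _ ↦ ⟨0, K.zero_mem, 0, K.zero_mem, rfl⟩
      symm := fun ⟨k, hk, k', hk', h⟩ ↦ ⟨k', hk', k, hk, h.symm⟩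
      trans := by
        rintro a b c ⟨k, hk, k', hk', h⟩ ⟨l, hl, l', hl', h'⟩
        refine ⟨k + l, K.add_mem hk hl, l' + k', K.add_mem hl' hk', ?_⟩
        rw [← add_assoc, h, add_right_comm, h', add_assoc] }
  add' := by
    rintro a b c d ⟨k, hk, k', hk', h⟩ ⟨l, hl, l', hl', h'⟩
    refine ⟨k + l, K.add_mem hk hl, k' + l', K.add_mem hk' hl', ?_⟩
    rw [add_add_add_comm, h, h', add_add_add_comm]
  smul := by
    rintro s a b ⟨k, hk, k', hk', h⟩
    refine ⟨s • k, K.smul_mem s hk, s • k', K.smul_mem s hk', ?_⟩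
    rw [← smul_add, h, smul_add]

theorem IsRightCPSemiring.exists_bourne_splitting (h : IsRightCPSemiring S)
    (K : Submodule Sᵐᵒᵖ S) :
    ∃ e : S, (∃ k ∈ K, ∃ k' ∈ K, e + k = 1 + k') ∧ e * e = e ∧ ∀ x ∈ K, e * x = 0 := by
  obtain ⟨e, he, hc⟩ := h.exists_splitting (bourneCon K)
  refine ⟨e, he, by simpa using hc e 1 he, fun x hx ↦ ?_⟩
  simpa using hc x 0 ⟨0, K.zero_mem, x, hx, by simp⟩

theorem mem_span_op_singleton {a x : S} :
    x ∈ Submodule.span Sᵐᵒᵖ {a} ↔ ∃ z, x = a * z := by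
  rw [Submodule.mem_span_singleton]
  exact ⟨fun ⟨z, hz⟩ ↦ ⟨z.unop, by simpa using hz.symm⟩, fun ⟨z, hz⟩ ↦ ⟨op z, by simp [hz]⟩⟩

end Splitting

/-! ### Additively idempotent semirings collapse to the Boolean semifield -/

section Idempotent

variable {S : Type u} [Semiring S]

theorem add_self_of_one_add_one (h1 : (1 : S) + 1 = 1) (a : S) : a + a = a := by
  simpa [mul_add] using congrArg (a * ·) h1

theorem eq_zero_of_add_eq_zero_of_one_add_one (h1 : (1 : S) + 1 = 1) {a b : S} (h : a + b = 0) :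
    a = 0 := by
  rw [← add_zero a, ← h, ← add_assoc, add_self_of_one_add_one h1]

/-- In an additively idempotent right subtractive semiring the principal right ideals are closed
downwards in the natural order. -/
theorem IsRightSubtractive.exists_eq_mul (hS : IsRightSubtractive S) {a b : S}
    (hab : a + b = a) : ∃ z, b = a * z :=
  mem_span_op_singleton.1 <| hS (Submodule.span Sᵐᵒᵖ {a}) a b
    (Submodule.mem_span_singleton_self a) (hab.symm ▸ Submodule.mem_span_singleton_self a)

/-- The Bourne splitting of `xS` gives `f + k = 1 + k'`, so `1` lies below `f + k` and equals `(f +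
k) * z` by subtractivity. Left multiplication by `f` kills `k` and shows `f * z = f`. -/
theorem exists_complement (hS : IsRightSubtractive S) (hP : IsRightCPSemiring S)
    (h1 : (1 : S) + 1 = 1) (x : S) :
    ∃ f w, f + x * w = 1 ∧ f * x = 0 := by
  obtain ⟨f, ⟨k, hk, k', -, h⟩, hff, hf⟩ :=
    hP.exists_bourne_splitting (Submodule.span Sᵐᵒᵖ {x})
  have hfk : f + k + 1 = f + k := by rw [h, add_right_comm, h1]
  obtain ⟨z, hz⟩ := hS.exists_eq_mul hfk
  obtain ⟨w, rfl⟩ := mem_span_op_singleton.1 hk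
  have hfx := hf x (Submodule.mem_span_singleton_self x)
  refine ⟨f, w * z, ?_, hfx⟩
  have hfz : f * z = f := by
    have := congrArg (f * ·) hz
    simp only [mul_one, add_mul, mul_add, ← mul_assoc, hff, hfx, zero_mul, add_zero] at this
    exact this.symm
  rw [hz, add_mul, hfz, mul_assoc]

/-- If `x * x = 0`, subtractivity gives `x ≤ 1`, hence `x ≤ w * x` where `x * w * x = x`. So `x`
lies in the right ideal of the idempotent `w * x`, which fixes it on the left but also kills it. -/
theorem eq_zero_of_mul_self (hS : IsRightSubtractive S) (hP : IsRightCPSemiring S)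
    (h1 : (1 : S) + 1 = 1) {x : S} (hx : x * x = 0) : x = 0 := by
  have hadd := add_self_of_one_add_one h1
  have hle : 1 + x = 1 := by
    obtain ⟨z, hz⟩ := hS.exists_eq_mul (a := 1 + x) (b := 1) (by rw [add_right_comm, h1])
    have hxz : x = x * z := by
      simpa [mul_add, add_mul, ← mul_assoc, hx] using congrArg (x * ·) hz
    have hz' : 1 = z + x := by rw [add_mul, one_mul, ← hxz] at hz; exact hz
    rw [hz', add_assoc, hadd]
  obtain ⟨f, w, hfw, hf⟩ := exists_complement hS hP h1 x
  have hreg : x * w * x = x := by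
    simpa [add_mul, hf] using congrArg (· * x) hfw
  have hwx : w * x + x = w * x := by
    have := congrArg (· * w * x) hle
    simpa [add_mul, hreg] using this
  obtain ⟨s, hs⟩ := hS.exists_eq_mul hwx
  have : w * x * x = x := by
    calc w * x * x = w * x * (w * x * s) := by rw [← hs]
      _ = w * (x * w * x) * s := by simp only [mul_assoc]
      _ = x := by rw [hreg, ← hs]
  rw [← this, mul_assoc, hx, mul_zero]

/-- If moreover central elements are either zero or not zero divisors, then nonzero elements are
right invertible. -/
theorem exists_mul_eq_one (hS : IsRightSubtractive S) (hP : IsRightCPSemiring S)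
    (h1 : (1 : S) + 1 = 1)
    (hsimple : ∀ f : S, (∀ a, f * a = a * f) → f = 0 ∨ ∀ x, f * x = 0 → x = 0)
    {x : S} (hx : x ≠ 0) : ∃ y, x * y = 1 := by
  have hred {a : S} (h : a * a = 0) : a = 0 := eq_zero_of_mul_self hS hP h1 h
  have hcomm {a b : S} (h : a * b = 0) : b * a = 0 :=
    hred (by rw [mul_assoc, ← mul_assoc a, h, zero_mul, mul_zero])
  obtain ⟨f, w, hfw, hf⟩ := exists_complement hS hP h1 x
  set k := x * w with hk
  have hfk : f * k = 0 := by rw [hk, ← mul_assoc, hf, zero_mul]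
  have hkf : k * f = 0 := hcomm hfk
  -- Without nilpotents, both off-diagonal Peirce components for `f + k = 1` vanish.
  have hfak (a : S) : f * a * k = 0 :=
    hred (by rw [mul_assoc, ← mul_assoc k, ← mul_assoc k, hkf, zero_mul, zero_mul, mul_zero])
  have hkaf (a : S) : k * a * f = 0 :=
    hred (by rw [mul_assoc, ← mul_assoc f, ← mul_assoc f, hfk, zero_mul, zero_mul, mul_zero])
  have hcen (a : S) : f * a = a * f := by
    have e1 : f * a = f * a * f := by
      have := congrArg (f * a * ·) hfw
      simpa [mul_add, hfak] using this.symm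
    have e2 : a * f = f * a * f := by
      have := congrArg (· * a * f) hfw
      simpa [add_mul, hkaf] using this.symm
    rw [e1, e2]
  rcases hsimple f hcen with h | h
  · exact ⟨w, by rw [← hfw, h, zero_add]⟩
  · exact absurd (h x hf) hx

/-- Merging all nonzero elements is a congruence, since there are no zero divisors and no nonzero
sums equal to zero. Its splitting `e` satisfies `e * a = e` for `a ≠ 0`; taking for `a` a right
inverse of `e` gives `e = 1`. -/
theorem eq_one_of_ne_zero [Nontrivial S] (hP : IsRightCPSemiring S) (h1 : (1 : S) + 1 = 1)
    (hinv : ∀ x : S, x ≠ 0 → ∃ y, x * y = 1) {a : S} (ha : a ≠ 0) : a = 1 := by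
  have hz {a b : S} : a + b = 0 ↔ a = 0 ∧ b = 0 :=
    ⟨fun h ↦ ⟨eq_zero_of_add_eq_zero_of_one_add_one h1 h,
      eq_zero_of_add_eq_zero_of_one_add_one h1 (add_comm a b ▸ h)⟩, fun h ↦ by simp [h]⟩
  have hm {a b : S} : a * b = 0 ↔ a = 0 ∨ b = 0 := by
    refine ⟨fun h ↦ or_iff_not_imp_right.2 fun hb ↦ ?_, fun h ↦ by rcases h with h | h <;> simp [h]⟩
    obtain ⟨y, hy⟩ := hinv b hb
    rw [← mul_one a, ← hy, ← mul_assoc, h, zero_mul]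
  let c : ModuleCon Sᵐᵒᵖ S :=
    { r := fun a b ↦ a = 0 ↔ b = 0
      iseqv := ⟨fun _ ↦ Iff.rfl, fun h ↦ h.symm, fun h h' ↦ h.trans h'⟩
      add' := fun h h' ↦ by rw [hz, hz, h, h']
      smul := fun s a b (h : a = 0 ↔ b = 0) ↦ by
        change a * s.unop = 0 ↔ b * s.unop = 0
        rw [hm, hm, h] }
  obtain ⟨e, he, hc⟩ := hP.exists_splitting c
  have he0 : e ≠ 0 := fun h ↦ one_ne_zero (he.1 h)
  have hconst {a : S} (ha : a ≠ 0) : e * a = e := by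
    simpa using hc a 1 (show a = 0 ↔ (1 : S) = 0 by simp [ha])
  obtain ⟨u, hu⟩ := hinv e he0
  have hu0 : u ≠ 0 := by rintro rfl; simp at hu
  have he1 : e = 1 := (hconst hu0).symm.trans hu
  simpa [he1] using hconst ha

theorem nonempty_ringEquiv_booleanSemifield [Nontrivial S] (h1 : (1 : S) + 1 = 1)
    (h : ∀ a : S, a ≠ 0 → a = 1) : Nonempty (S ≃+* BooleanSemifield) := by
  classical
  have h01 (a : S) : a = 0 ∨ a = 1 := or_iff_not_imp_left.2 (h a)
  have h1' : (1 : BooleanSemifield) + 1 = 1 := rfl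
  have hB : (1 : BooleanSemifield) ≠ 0 := Bool.noConfusion
  let φ : S →+* BooleanSemifield :=
    { toFun := fun a ↦ if a = 0 then 0 else 1
      map_zero' := if_pos rfl
      map_one' := if_neg one_ne_zero
      map_mul' := fun a b ↦ by
        rcases h01 a with rfl | rfl <;> rcases h01 b with rfl | rfl <;> simp
      map_add' := fun a b ↦ by
        rcases h01 a with rfl | rfl <;> rcases h01 b with rfl | rfl <;> simp [h1, h1'] }
  refine ⟨.ofBijective φ ⟨fun a b hab ↦ ?_, fun b ↦ ?_⟩⟩
  · rcases h01 a with rfl | rfl <;> rcases h01 b with rfl | rfl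
    exacts [rfl, absurd hab.symm (by simp), absurd hab (by simp), rfl]
  · match b with
    | false => exact ⟨0, φ.map_zero⟩
    | true => exact ⟨1, φ.map_one⟩

end Idempotent

/-! ### Consequences of simplicity -/

section Simple

variable {S : Type u} [Semiring S]

/-- Two elements are related if they differ by an additively invertible element. -/
def addUnitCon (S : Type*) [Semiring S] : RingCon S where
  r a b := ∃ v, IsAddUnit v ∧ a = b + v
  iseqv :=
    { refl := fun a ↦ ⟨0, isAddUnit_zero, by simp⟩
      symm := by
        rintro a b ⟨v, hv, rfl⟩
        obtain ⟨w, hw⟩ := hv.exists_neg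
        exact ⟨w, .of_add_eq_zero v (by rw [add_comm, hw]), by rw [add_assoc, hw, add_zero]⟩
      trans := by
        rintro a b c ⟨v, hv, rfl⟩ ⟨w, hw, rfl⟩
        exact ⟨w + v, hw.add hv, by rw [add_assoc]⟩ }
  add' := by
    rintro a b c d ⟨v, hv, rfl⟩ ⟨w, hw, rfl⟩
    exact ⟨v + w, hv.add hw, by rw [add_add_add_comm]⟩
  mul' := by
    rintro a b c d ⟨v, hv, rfl⟩ ⟨w, hw, rfl⟩
    obtain ⟨v', hv'⟩ := hv.exists_neg
    obtain ⟨w', hw'⟩ := hw.exists_neg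
    have h1 : IsAddUnit (v * (d + w)) :=
      .of_add_eq_zero (v' * (d + w)) (by rw [← add_mul, hv', zero_mul])
    have h2 : IsAddUnit (b * w) := .of_add_eq_zero (b * w') (by rw [← mul_add, hw', mul_zero])
    exact ⟨_, h2.add h1, by rw [add_mul, mul_add b, add_assoc]⟩

/-- Two elements are related if they are annihilated by the same multiplications from both sides. -/
def annihilatorCon (hz : ∀ a b : S, a + b = 0 ↔ a = 0 ∧ b = 0) : RingCon S where
  r a b := ∀ x y, x * a * y = 0 ↔ x * b * y = 0
  iseqv := ⟨fun _ _ _ ↦ Iff.rfl, fun h x y ↦ (h x y).symm,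
    fun h h' x y ↦ (h x y).trans (h' x y)⟩
  add' h h' x y := by simp only [mul_add, add_mul, hz, h x y, h' x y]
  mul' {a b c d} h h' x y := by
    have e1 := h x (c * y)
    have e2 := h' (x * b) y
    simp only [mul_assoc] at e1 e2 ⊢
    exact e1.trans e2

theorem one_add_one_of_isCongruenceSimple [Nontrivial S] (h : IsCongruenceSimple S)
    (hz : ∀ a b : S, a + b = 0 ↔ a = 0 ∧ b = 0) : (1 : S) + 1 = 1 := by
  rcases h (annihilatorCon hz) with h | h
  · have : annihilatorCon hz (1 + 1) 1 := fun x y ↦ by simp [mul_add, add_mul, hz]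
    rwa [h] at this
  · have : annihilatorCon hz 1 0 := by rw [h]; trivial
    simpa using this 1 1

/-- Elements with equal right annihilators are identified, so `1 + 1` is related to `1` and the
splitting `e` is a nonzero additive idempotent. Additive idempotents form a two-sided ideal, which
must then contain `1`. -/
theorem one_add_one_of_isIdealSimple [Nontrivial S] (h : IsIdealSimple S)
    (hP : IsRightCPSemiring S) (hz : ∀ a b : S, a + b = 0 ↔ a = 0 ∧ b = 0) :
    (1 : S) + 1 = 1 := by
  let c : ModuleCon Sᵐᵒᵖ S :=
    { r := fun a b ↦ ∀ y, a * y = 0 ↔ b * y = 0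
      iseqv := ⟨fun _ _ ↦ Iff.rfl, fun h y ↦ (h y).symm, fun h h' y ↦ (h y).trans (h' y)⟩
      add' := fun h h' y ↦ by simp only [add_mul, hz, h y, h' y]
      smul := fun s a b (h : ∀ y, a * y = 0 ↔ b * y = 0) y ↦ by
        simpa [mul_assoc] using h (s.unop * y) }
  obtain ⟨e, he, hc⟩ := hP.exists_splitting c
  have hee : e + e = e := by
    simpa [mul_add] using hc (1 + 1) 1 fun y ↦ by simp [add_mul, hz]
  let I : Ideal S :=
    { carrier := {x | x + x = x}
      zero_mem' := add_zero 0
      add_mem' := fun {a b} (ha : a + a = a) (hb : b + b = b) ↦ by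
        change a + b + (a + b) = a + b
        rw [add_add_add_comm, ha, hb]
      smul_mem' := fun s a (ha : a + a = a) ↦ by
        change s * a + s * a = s * a
        rw [← mul_add, ha] }
  have hI : I.IsTwoSided := ⟨fun {a} b (ha : a + a = a) ↦ by
    change a * b + a * b = a * b
    rw [← add_mul, ha]⟩
  rcases h I hI with h | h
  · have : e ∈ I := hee
    rw [h, Ideal.mem_bot] at this
    exact absurd ((he 1).1 (by simp [this])) (by simp)
  · exact show (1 : S) ∈ I by rw [h]; trivial

theorem isAddUnit_or_of_isCongruenceSimple (h : IsCongruenceSimple S) :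
    (∀ a : S, IsAddUnit a) ∨ ∀ a : S, IsAddUnit a → a = 0 := by
  rcases h (addUnitCon S) with h | h
  · refine .inr fun a ha ↦ ?_
    have : addUnitCon S a 0 := ⟨a, ha, by simp⟩
    rwa [h] at this
  · refine .inl fun a ↦ ?_
    obtain ⟨v, hv, e⟩ : addUnitCon S a 0 := by rw [h]; trivial
    rwa [e, zero_add]

theorem isAddUnit_or_of_isIdealSimple (h : IsIdealSimple S) :
    (∀ a : S, IsAddUnit a) ∨ ∀ a : S, IsAddUnit a → a = 0 := by
  let I : Ideal S :=
    { carrier := {x | IsAddUnit x}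
      zero_mem' := isAddUnit_zero
      add_mem' := fun ha hb ↦ IsAddUnit.add ha hb
      smul_mem' := fun s a (ha : IsAddUnit a) ↦ by
        obtain ⟨b, hb⟩ := ha.exists_neg
        exact .of_add_eq_zero (s * b) (by rw [smul_eq_mul, ← mul_add, hb, mul_zero]) }
  have hI : I.IsTwoSided := ⟨fun {a} s (ha : IsAddUnit a) ↦ by
    obtain ⟨b, hb⟩ := ha.exists_neg
    exact .of_add_eq_zero (b * s) (by rw [← add_mul, hb, zero_mul])⟩
  rcases h I hI with h | h
  · exact .inr fun a ha ↦ by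
      have : a ∈ I := ha
      rwa [h] at this
  · exact .inl fun a ↦ show a ∈ I by rw [h]; trivial

theorem central_of_isCongruenceSimple (h : IsCongruenceSimple S) (f : S)
    (hf : ∀ a, f * a = a * f) : f = 0 ∨ ∀ x, f * x = 0 → x = 0 := by
  let c : RingCon S :=
    { r := fun a b ↦ f * a = f * b
      iseqv := ⟨fun _ ↦ rfl, Eq.symm, Eq.trans⟩
      add' := fun h h' ↦ by rw [mul_add, mul_add, h, h']
      mul' := fun {a b c d} h h' ↦ by
        rw [← mul_assoc, h, ← mul_assoc, hf b, mul_assoc, h', ← mul_assoc] }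
  rcases h c with h | h
  · refine .inr fun x hx ↦ ?_
    have : c x 0 := show f * x = f * 0 by simpa
    rwa [h] at this
  · have : c 1 0 := by rw [h]; trivial
    exact .inl (by simpa using show f * 1 = f * 0 from this)

theorem central_of_isIdealSimple (h : IsIdealSimple S) (f : S)
    (hf : ∀ a, f * a = a * f) : f = 0 ∨ ∀ x, f * x = 0 → x = 0 := by
  let I : Ideal S :=
    { carrier := {x | f * x = 0}
      zero_mem' := mul_zero f
      add_mem' := fun {a b} (ha : f * a = 0) (hb : f * b = 0) ↦ by
        change f * (a + b) = 0
        rw [mul_add, ha, hb, add_zero]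
      smul_mem' := fun s a (ha : f * a = 0) ↦ by
        change f * (s * a) = 0
        rw [← mul_assoc, hf, mul_assoc, ha, mul_zero] }
  have hI : I.IsTwoSided := ⟨fun {a} s (ha : f * a = 0) ↦ by
    change f * (a * s) = 0
    rw [← mul_assoc, ha, zero_mul]⟩
  rcases h I hI with h | h
  · exact .inr fun x hx ↦ by
      have : x ∈ I := hx
      rwa [h] at this
  · have : (1 : S) ∈ I := by rw [h]; trivial
    exact .inl (by simpa using show f * 1 = 0 from this)

theorem nonempty_ringEquiv_booleanSemifield_of_central [Nontrivial S]
    (hS : IsRightSubtractive S) (hP : IsRightCPSemiring S) (h1 : (1 : S) + 1 = 1)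
    (hc : ∀ f : S, (∀ a, f * a = a * f) → f = 0 ∨ ∀ x, f * x = 0 → x = 0) :
    Nonempty (S ≃+* BooleanSemifield) :=
  nonempty_ringEquiv_booleanSemifield h1 fun _ ha ↦
    eq_one_of_ne_zero hP h1 (fun _ hx ↦ exists_mul_eq_one hS hP h1 hc hx) ha

end Simple

/-! ### The ring case -/

section Ring

/-- The Bourne splitting `e` of a right ideal `K` kills `K` and has `1 - e ∈ K`, so `eR` is a
complement of `K`. -/
theorem isSemisimpleRing_of_isRightCPSemiring {R : Type u} [Ring R] (h : IsRightCPSemiring R) :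
    IsSemisimpleRing R := by
  have hR : IsSemisimpleModule Rᵐᵒᵖ R := by
    rw [isSemisimpleModule_iff]
    refine ⟨fun K ↦ ?_⟩
    obtain ⟨e, ⟨k, hk, k', hk', hkk⟩, hee, he⟩ := h.exists_bourne_splitting K
    have hK : 1 - e ∈ K := by
      rw [show 1 - e = k - k' by rw [sub_eq_sub_iff_add_eq_add, ← hkk, add_comm]]
      exact K.sub_mem hk hk'
    refine ⟨Submodule.span Rᵐᵒᵖ {e}, ?_, ?_⟩
    · rw [Submodule.disjoint_def]
      intro x hx hxe
      obtain ⟨z, rfl⟩ := mem_span_op_singleton.1 hxe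
      rw [← he _ hx, ← mul_assoc, hee]
    · rw [codisjoint_iff, eq_top_iff]
      intro x _
      have hx : x = (1 - e) * x + e * x := by rw [← add_mul, sub_add_cancel, one_mul]
      rw [hx]
      exact Submodule.add_mem_sup (K.smul_mem (op x) hK) (mem_span_op_singleton.2 ⟨x, rfl⟩)
  rw [← isSemisimpleRing_mulOpposite_iff]
  let e : Rᵐᵒᵖ ≃ₗ[Rᵐᵒᵖ] R :=
    { (opAddEquiv (α := R)).symm with map_smul' := fun _ _ ↦ rfl }
  exact IsSemisimpleModule.congr e

theorem isRightCPSemiring_of_isSemisimpleRing {R : Type u} [Ring R] [IsSemisimpleRing R] :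
    IsRightCPSemiring R := by
  intro M _ _ _
  let _ : AddCommGroup M := Module.addCommMonoidToAddCommGroup Rᵐᵒᵖ
  exact Module.projective_of_isSemisimpleRing Rᵐᵒᵖ M

theorem isSimpleRing_iff_isIdealSimple {R : Type*} [Ring R] [Nontrivial R] :
    IsSimpleRing R ↔ IsIdealSimple R := by
  rw [isSimpleRing_iff_isTwoSided_imp]
  exact and_iff_right ‹_›

theorem isSimpleRing_iff_isCongruenceSimple {R : Type*} [Ring R] [Nontrivial R] :
    IsSimpleRing R ↔ IsCongruenceSimple R := by
  rw [isSimpleRing_iff, TwoSidedIdeal.orderIsoRingCon.isSimpleOrder_iff, isSimpleOrder_iff]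
  exact and_iff_right inferInstance

/-- A semiring all of whose elements have additive inverses is a ring. -/
noncomputable abbrev ringOfIsAddUnit {S : Type*} [inst : Semiring S] (h : ∀ a : S, IsAddUnit a) :
    Ring S :=
  letI : Neg S := ⟨fun a ↦ (h a).exists_neg.choose⟩
  { inst with
    zsmul := zsmulRec
    neg_add_cancel := fun a ↦ (add_comm _ _).trans (h a).exists_neg.choose_spec }

theorem exists_matrix_of_isSimpleRing {R : Type u} [Ring R] [IsSimpleRing R]
    (h : IsRightCPSemiring R) :
    ∃ (D : Type u) (_ : DivisionRing D) (n : ℕ),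
      1 ≤ n ∧ Nonempty (R ≃+* Matrix (Fin n) (Fin n) D) := by
  have := isSemisimpleRing_of_isRightCPSemiring h
  obtain ⟨n, hn, D, hD, e⟩ := IsSimpleRing.exists_ringEquiv_matrix_divisionRing R
  exact ⟨D, hD, n, Nat.one_le_iff_ne_zero.2 hn.out, e⟩

theorem simple_and_isRightCPSemiring_of_matrix {R D : Type u} [Ring R] [DivisionRing D] {n : ℕ}
    (hn : 1 ≤ n) (e : R ≃+* Matrix (Fin n) (Fin n) D) :
    IsCongruenceSimple R ∧ IsIdealSimple R ∧ IsRightCPSemiring R := by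
  have : NeZero n := ⟨Nat.one_le_iff_ne_zero.1 hn⟩
  have : IsSimpleRing R := .of_ringEquiv e.symm inferInstance
  have : IsSemisimpleRing R := e.symm.isSemisimpleRing
  exact ⟨isSimpleRing_iff_isCongruenceSimple.1 ‹_›, isSimpleRing_iff_isIdealSimple.1 ‹_›,
    isRightCPSemiring_of_isSemisimpleRing⟩

end Ring

/-! ### The Boolean case -/

section Boolean

theorem simple_and_isRightCPSemiring_of_boolean {S : Type u} [Semiring S] [Nontrivial S]
    (e : S ≃+* BooleanSemifield) :
    IsCongruenceSimple S ∧ IsIdealSimple S ∧ IsRightCPSemiring S := by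
  have h01 (a : S) : a = 0 ∨ a = 1 := by
    have hB : ∀ b : BooleanSemifield, b = 0 ∨ b = 1
      | false => .inl rfl
      | true => .inr rfl
    rcases hB (e a) with h | h
    · exact .inl (by simpa using h)
    · exact .inr (by simpa using h)
  refine ⟨fun c ↦ ?_, fun I _ ↦ ?_, fun M _ _ ⟨f, hf⟩ ↦ ?_⟩
  · by_cases h : c 0 1
    · refine .inr (RingCon.ext fun a b ↦ ⟨fun _ ↦ trivial, fun _ ↦ ?_⟩)
      have h0 (a : S) : c 0 a := by
        rcases h01 a with rfl | rfl
        exacts [c.refl _, h]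
      exact c.trans (c.symm (h0 a)) (h0 b)
    · refine .inl (RingCon.ext fun a b ↦ ⟨fun hab ↦ ?_, ?_⟩)
      · change a = b
        rcases h01 a with rfl | rfl <;> rcases h01 b with rfl | rfl
        exacts [rfl, absurd hab h, absurd (c.symm hab) h, rfl]
      · rintro (rfl : a = b)
        exact c.refl a
  · by_cases h : (1 : S) ∈ I
    · exact .inr ((Ideal.eq_top_iff_one I).2 h)
    · refine .inl ((Submodule.eq_bot_iff _).2 fun x hx ↦ ?_)
      rcases h01 x with rfl | rfl
      exacts [rfl, absurd hx h]
  · let o : Sᵐᵒᵖ ≃ₗ[Sᵐᵒᵖ] S :=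
      { (opAddEquiv (α := S)).symm with map_smul' := fun _ _ ↦ rfl }
    -- With two elements in `S`, a cyclic semimodule is either zero or a copy of `S`.
    by_cases h : f 1 = 0
    · have : Subsingleton M := subsingleton_of_forall_eq 0 fun m ↦ by
        obtain ⟨a, rfl⟩ := hf m
        rcases h01 a with rfl | rfl
        exacts [map_zero f, h]
      infer_instance
    · have hinj : Function.Injective f := fun a b hab ↦ by
        rcases h01 a with rfl | rfl <;> rcases h01 b with rfl | rfl
        exacts [rfl, absurd (hab.symm.trans (map_zero f)) h, absurd (hab.trans (map_zero f)) h, rfl]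
      exact .of_equiv (o.trans (.ofBijective f ⟨hinj, hf⟩))

end Boolean

/-! ### The equivalence -/

theorem corollary4p11 (S : Type u) [Semiring S] [Nontrivial S] (hS : IsRightSubtractive S) :
    [IsCongruenceSimple S ∧ IsRightCPSemiring S,
      IsIdealSimple S ∧ IsRightCPSemiring S,
      (∃ (D : Type u) (_ : DivisionRing D) (n : ℕ),
          1 ≤ n ∧ Nonempty (S ≃+* Matrix (Fin n) (Fin n) D)) ∨
        Nonempty (S ≃+* BooleanSemifield)].TFAE := by
  have hz (h : ∀ a : S, IsAddUnit a → a = 0) (a b : S) : a + b = 0 ↔ a = 0 ∧ b = 0 :=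
    ⟨fun hab ↦ ⟨h a (.of_add_eq_zero b hab), h b (.of_add_eq_zero a (add_comm a b ▸ hab))⟩,
      fun hab ↦ by simp [hab]⟩
  have h31 : ((∃ (D : Type u) (_ : DivisionRing D) (n : ℕ),
          1 ≤ n ∧ Nonempty (S ≃+* Matrix (Fin n) (Fin n) D)) ∨
        Nonempty (S ≃+* BooleanSemifield)) →
      IsCongruenceSimple S ∧ IsIdealSimple S ∧ IsRightCPSemiring S := by
    rintro (⟨D, _, n, hn, ⟨e⟩⟩ | ⟨⟨e⟩⟩)
    -- Negatives are pulled back along `e`, keeping the given semiring structure on `S`.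
    · let _ : Ring S := ringOfIsAddUnit fun a ↦ .of_add_eq_zero (e.symm (-e a)) <| by
        rw [← e.symm_apply_apply (a + e.symm (-e a))]; simp
      exact simple_and_isRightCPSemiring_of_matrix hn e
    · exact simple_and_isRightCPSemiring_of_boolean e
  tfae_have 1 → 3 := by
    rintro ⟨h, hP⟩
    rcases isAddUnit_or_of_isCongruenceSimple h with hu | hu
    · let _ : Ring S := ringOfIsAddUnit hu
      have : IsSimpleRing S := isSimpleRing_iff_isCongruenceSimple.2 h
      exact .inl (exists_matrix_of_isSimpleRing hP)
    · exact .inr (nonempty_ringEquiv_booleanSemifield_of_central hS hP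
        (one_add_one_of_isCongruenceSimple h (hz hu)) (central_of_isCongruenceSimple h))
  tfae_have 2 → 3 := by
    rintro ⟨h, hP⟩
    rcases isAddUnit_or_of_isIdealSimple h with hu | hu
    · let _ : Ring S := ringOfIsAddUnit hu
      have : IsSimpleRing S := isSimpleRing_iff_isIdealSimple.2 h
      exact .inl (exists_matrix_of_isSimpleRing hP)
    · exact .inr (nonempty_ringEquiv_booleanSemifield_of_central hS hP
        (one_add_one_of_isIdealSimple h hP (hz hu)) (central_of_isIdealSimple h))
  tfae_have 3 → 1 := fun h ↦ ⟨(h31 h).1, (h31 h).2.2⟩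
  tfae_have 3 → 2 := fun h ↦ (h31 h).2
  tfae_finish
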